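/- Let $\mathbb{B}$ be the open unit ball of the space $\mathbb{C}^{2\times 2}$ of $2\times 2$ complex matrices in the operator norm (induced by the Euclidean norm on $\mathbb{C}^2$), and let \[ \mathcal{P}=\{(a_{21},\operatorname{tr}A,\det A): A=[a_{ij}]_{i,j=1}^2\in\mathbb{B}\}\subset\mathbb{C}^3 \] be the pentablock, with closure $\overline{\mathcal{P}}$ in $\mathbb{C}^3$. For $K\subset\mathbb{C}^n$ let \[ \widehat K=\{z\in\mathbb{C}^n: |f(z)|\le \sup_{K}|f| \text{ for every complex polynomial } f \text{ in } n \text{ variables}\} \] be its polynomial hull. A domain (nonempty connected open set) $\Omega\subset\mathbb{C}^n$ is called polynomially convex if $\widehat K\subset\Omega$ for every compact $K\subset\Omega$; a compact set $K\subset\mathbb{C}^n$ is called polynomially convex if $\widehat K=K$. Theorem. $\mathcal{P}$ is a polynomially convex domain, and $\overline{\mathcal{P}}$ is a polynomially convex compact set. -/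

import Mathlib

/-- The polynomial hull of `K ⊆ ℂⁿ`: the points `z` with `|f z| ≤ sup_K |f|` for every
polynomial `f`. The supremum is expressed by quantifying over all upper bounds `M` of `|f|`
on `K`. -/
def polynomialHull {n : ℕ} (K : Set (Fin n → ℂ)) : Set (Fin n → ℂ) :=
  {z | ∀ (f : MvPolynomial (Fin n) ℂ) (M : ℝ),
    (∀ w ∈ K, ‖MvPolynomial.eval w f‖ ≤ M) → ‖MvPolynomial.eval z f‖ ≤ M}

/-- A domain (nonempty connected open set) `Ω` in `ℂⁿ` is polynomially convex if the polynomial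
hull of each compact subset of `Ω` is contained in `Ω`. -/
structure IsPolynomiallyConvexDomain {n : ℕ} (Ω : Set (Fin n → ℂ)) : Prop where
  isOpen : IsOpen Ω
  isConnected : IsConnected Ω
  hull_subset : ∀ K : Set (Fin n → ℂ), IsCompact K → K ⊆ Ω → polynomialHull K ⊆ Ω

/-- A compact set in `ℂⁿ` is polynomially convex if it equals its polynomial hull. -/
structure IsPolynomiallyConvexCompact {n : ℕ} (K : Set (Fin n → ℂ)) : Prop where
  isCompact : IsCompact K
  hull_eq : polynomialHull K = K

/-- The open unit ball of the `2 × 2` complex matrices in the usual operator norm, that is,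
the norm of `A` as an operator on the Hilbert space `ℂ²`. -/
def matrixUnitBall : Set (Matrix (Fin 2) (Fin 2) ℂ) :=
  {A | ‖Matrix.toEuclideanCLM (n := Fin 2) (𝕜 := ℂ) A‖ < 1}

/-- The map `A ↦ (a₂₁, tr A, det A)`. Matrix indices start at `0`, so `a₂₁` is `A 1 0`. -/
def pentablockMap (A : Matrix (Fin 2) (Fin 2) ℂ) : Fin 3 → ℂ :=
  ![A 1 0, A.trace, A.det]

/-- The pentablock. -/
def pentablock : Set (Fin 3 → ℂ) :=
  pentablockMap '' matrixUnitBall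

/-!
Write `q(z) = 1 - s z + p z²` for a point `(a, s, p)` of `ℂ³`, and let `λ`, `μ` be the numbers
with `λ + μ = s` and `λ μ = p`.

If the point comes from a contraction `A`, then `det (1 - z A) = q(z)`, and comparing
`A v - conj z v` with `v - z A v` for a column `v` of the adjugate of `1 - z A` gives
`|a| (1 - |z|²) ≤ |q(z)|` on the unit disc. Conversely, when `λ` and `μ` lie in the open disc, the
strict form of this inequality at the single point `z = conj w`, where `w` is the hyperbolic
midpoint of `λ` and `μ`, already yields a strict contraction over `(a, s, p)`: a `2 × 2` matrix
with `|det A| < 1` is one as soon as the sum of its `|aᵢⱼ|²` is less than `1 + |det A|²`, and a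
matrix making that sum small can be written down.

On the closed bidisc of pairs `(λ, μ)` the expansion `1 / q(z) = ∑ hₙ(λ, μ) zⁿ` has coefficients
bounded by `n + 1`. Here `hₙ`, the complete homogeneous symmetric polynomial, is the Dickson
polynomial of the second kind in `s` with parameter `p`. Being polynomial in `(s, p)`, the
coefficients satisfy the same bounds on the polynomial hull of the pentablock, so `a / q(z)` is a
uniform limit of polynomials there. Hence the hull inherits both `q(z) ≠ 0` and
`|a| (1 - |z|²) ≤ |q(z)|`, and for `0 < r < 1` the dilation `(r a, r s, r² p)` makes the
inequality strict, so it maps the hull into the pentablock.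

A compact subset of the pentablock can first be dilated by some `t > 1` within the open
pentablock, and dilating its hull back by `1 / t` keeps it inside. Letting `r → 1` gives the claim
on the closure.
-/

open Filter Topology ComplexConjugate

section PolynomialHull

variable {m n : ℕ} {K Ω : Set (Fin n → ℂ)} {x : Fin n → ℂ}

theorem subset_polynomialHull (K : Set (Fin n → ℂ)) : K ⊆ polynomialHull K :=
  fun _ hz _ _ hM => hM _ hz

theorem polynomialHull_closure (K : Set (Fin n → ℂ)) :
    polynomialHull (closure K) = polynomialHull K := by
  refine Set.Subset.antisymm (fun x hx f M hM => hx f M ?_)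
    fun x hx f M hM => hx f M fun w hw => hM w (subset_closure hw)
  exact closure_minimal (t := {w | ‖MvPolynomial.eval w f‖ ≤ M}) hM
    (isClosed_le (MvPolynomial.continuous_eval f).norm continuous_const)

theorem mapsTo_polynomialHull {L : Set (Fin m → ℂ)} {φ : Fin m → MvPolynomial (Fin n) ℂ}
    (h : Set.MapsTo (fun x i => MvPolynomial.eval x (φ i)) K L) :
    Set.MapsTo (fun x i => MvPolynomial.eval x (φ i)) (polynomialHull K) (polynomialHull L) := by
  intro x hx f M hM
  have eval_bind (y : Fin n → ℂ) : MvPolynomial.eval y (MvPolynomial.bind₁ φ f) =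
      MvPolynomial.eval (fun i => MvPolynomial.eval y (φ i)) f :=
    MvPolynomial.eval₂Hom_bind₁ _ _ _ _
  rw [← eval_bind]
  exact hx _ M fun y hy => eval_bind y ▸ hM _ (h hy)

theorem norm_le_of_tendstoUniformlyOn_polynomialHull {ι : Type*} {l : Filter ι} [l.NeBot]
    {F : ι → MvPolynomial (Fin n) ℂ} {g : (Fin n → ℂ) → ℂ} {M : ℝ}
    (hF : TendstoUniformlyOn (fun i y => MvPolynomial.eval y (F i)) g l (polynomialHull K))
    (hg : ∀ y ∈ K, ‖g y‖ ≤ M) (hx : x ∈ polynomialHull K) : ‖g x‖ ≤ M := by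
  refine le_of_forall_pos_le_add fun ε hε => ?_
  obtain ⟨i, hi⟩ := (Metric.tendstoUniformlyOn_iff.1 hF (ε / 2) (half_pos hε)).exists
  simp_rw [dist_eq_norm] at hi
  have hFx : ‖MvPolynomial.eval x (F i)‖ ≤ M + ε / 2 := hx _ _ fun y hy =>
    (norm_le_norm_add_norm_sub _ _).trans
      (add_le_add (hg y hy) (hi y (subset_polynomialHull K hy)).le)
  linarith [norm_le_norm_add_norm_sub' (g x) (MvPolynomial.eval x (F i)), hi x hx]

/-- The dilation `(xᵢ) ↦ (t ^ dᵢ xᵢ)` of `ℂⁿ` with weights `dᵢ`. -/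
def weightedDilation (d : Fin n → ℕ) (t : ℝ) (x : Fin n → ℂ) : Fin n → ℂ :=
  fun i => t ^ d i * x i

variable {d : Fin n → ℕ}

theorem continuous_weightedDilation (d : Fin n → ℕ) :
    Continuous fun q : ℝ × (Fin n → ℂ) => weightedDilation d q.1 q.2 := by
  unfold weightedDilation
  fun_prop

theorem weightedDilation_one (d : Fin n → ℕ) (x : Fin n → ℂ) : weightedDilation d 1 x = x := by
  funext i
  simp [weightedDilation]

theorem weightedDilation_inv_weightedDilation {t : ℝ} (ht : t ≠ 0) (d : Fin n → ℕ)
    (x : Fin n → ℂ) : weightedDilation d t⁻¹ (weightedDilation d t x) = x := by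
  funext i
  simp [weightedDilation, ht]

theorem mapsTo_weightedDilation_polynomialHull {L : Set (Fin n → ℂ)} {t : ℝ}
    (h : Set.MapsTo (weightedDilation d t) K L) :
    Set.MapsTo (weightedDilation d t) (polynomialHull K) (polynomialHull L) := by
  have key : weightedDilation d t = fun x i =>
      MvPolynomial.eval x (MvPolynomial.C ((t : ℂ) ^ d i) * MvPolynomial.X i) := by
    funext x i
    simp [weightedDilation]
  rw [key] at h ⊢
  exact mapsTo_polynomialHull h

theorem polynomialHull_subset_of_weightedDilation (hΩ : IsOpen Ω)
    (hd : ∀ r ∈ Set.Ioo (0 : ℝ) 1, Set.MapsTo (weightedDilation d r) (polynomialHull Ω) Ω)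
    (hK : IsCompact K) (hKΩ : K ⊆ Ω) : polynomialHull K ⊆ Ω := by
  intro x hx
  have expand : ∀ᶠ t : ℝ in 𝓝 1, ∀ y ∈ K, weightedDilation d t y ∈ Ω :=
    hK.eventually_forall_of_forall_eventually fun y hy =>
      (continuous_weightedDilation d).continuousAt.eventually_mem
        (hΩ.mem_nhds ((weightedDilation_one d y).symm ▸ hKΩ hy))
  obtain ⟨t, htK, ht : 1 < t⟩ :=
    ((expand.filter_mono nhdsWithin_le_nhds).and (self_mem_nhdsWithin (s := Set.Ioi 1))).exists
  have ht₀ : 0 < t := one_pos.trans ht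
  rw [← weightedDilation_inv_weightedDilation ht₀.ne' d x]
  exact hd t⁻¹ ⟨inv_pos.2 ht₀, inv_lt_one_of_one_lt₀ ht⟩
    (mapsTo_weightedDilation_polynomialHull htK hx)

theorem polynomialHull_closure_eq_of_weightedDilation
    (hd : ∀ r ∈ Set.Ioo (0 : ℝ) 1, Set.MapsTo (weightedDilation d r) (polynomialHull Ω) Ω) :
    polynomialHull (closure Ω) = closure Ω := by
  refine Set.Subset.antisymm (fun x hx => ?_) (subset_polynomialHull _)
  rw [polynomialHull_closure] at hx
  have hlim : Tendsto (fun r : ℝ => weightedDilation d r x) (𝓝[<] 1) (𝓝 x) := by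
    have hcont : Continuous fun r : ℝ => weightedDilation d r x :=
      (continuous_weightedDilation d).comp (by fun_prop : Continuous fun r : ℝ => (r, x))
    exact (weightedDilation_one d x ▸ hcont.tendsto 1).mono_left nhdsWithin_le_nhds
  refine mem_closure_of_tendsto hlim ?_
  filter_upwards [Ioo_mem_nhdsLT (zero_lt_one' ℝ)] with r hr using hd r hr hx

end PolynomialHull

section Mobius

variable {𝕜 E : Type*} [RCLike 𝕜] [NormedAddCommGroup E] [InnerProductSpace 𝕜 E]
  {z : 𝕜} {u v : E}

theorem norm_sub_smul_sq_sub_norm_sub_conj_smul_sq (z : 𝕜) (u v : E) :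
    ‖v - z • u‖ ^ 2 - ‖u - conj z • v‖ ^ 2 = (1 - ‖z‖ ^ 2) * (‖v‖ ^ 2 - ‖u‖ ^ 2) := by
  have cross : RCLike.re (inner 𝕜 u (conj z • v)) = RCLike.re (inner 𝕜 v (z • u)) := by
    rw [← inner_conj_symm, RCLike.conj_re, inner_smul_left, RCLike.conj_conj, inner_smul_right]
  rw [norm_sub_sq (𝕜 := 𝕜), norm_sub_sq (𝕜 := 𝕜), cross, norm_smul, norm_smul, RCLike.norm_conj]
  ring

theorem norm_sub_conj_smul_le (hz : ‖z‖ ≤ 1) (h : ‖u‖ ≤ ‖v‖) :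
    ‖u - conj z • v‖ ≤ ‖v - z • u‖ := by
  rw [← sq_le_sq₀ (norm_nonneg _) (norm_nonneg _), ← sub_nonneg,
    norm_sub_smul_sq_sub_norm_sub_conj_smul_sq]
  exact mul_nonneg (sub_nonneg.2 (pow_le_one₀ (norm_nonneg z) hz))
    (sub_nonneg.2 (pow_le_pow_left₀ (norm_nonneg u) h 2))

theorem norm_sub_conj_smul_lt (hz : ‖z‖ < 1) (h : ‖u‖ < ‖v‖) :
    ‖u - conj z • v‖ < ‖v - z • u‖ := by
  rw [← sq_lt_sq₀ (norm_nonneg _) (norm_nonneg _), ← sub_pos,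
    norm_sub_smul_sq_sub_norm_sub_conj_smul_sq]
  exact mul_pos (sub_pos.2 (pow_lt_one₀ (norm_nonneg z) hz two_ne_zero))
    (sub_pos.2 (pow_lt_pow_left₀ h (norm_nonneg u) two_ne_zero))

theorem exists_one_add_norm_sq_smul_eq_two_smul {F : Type*} [NormedAddCommGroup F]
    [NormedSpace ℝ F] {b : F} (hb : ‖b‖ < 1) :
    ∃ w : F, ‖w‖ < 1 ∧ (1 + ‖w‖ ^ 2) • b = (2 : ℝ) • w := by
  have hsqrt : √(1 - ‖b‖ ^ 2) ^ 2 = 1 - ‖b‖ ^ 2 :=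
    Real.sq_sqrt (sub_nonneg.2 (pow_le_one₀ (norm_nonneg b) hb.le))
  set t := √(1 - ‖b‖ ^ 2)
  have ht : 0 < 1 + t := add_pos_of_pos_of_nonneg one_pos (Real.sqrt_nonneg _)
  have hnorm : ‖(1 + t)⁻¹ • b‖ = (1 + t)⁻¹ * ‖b‖ := by
    rw [norm_smul, norm_inv, Real.norm_of_nonneg ht.le]
  refine ⟨(1 + t)⁻¹ • b, ?_, ?_⟩
  · rw [hnorm, inv_mul_lt_iff₀ ht]
    linarith [Real.sqrt_nonneg (1 - ‖b‖ ^ 2)]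
  · rw [hnorm, smul_smul]
    congr 1
    field_simp
    linear_combination hsqrt

theorem norm_add_sub_conj_mul_lt {a b : ℂ} (ha : ‖a‖ < 1) (hb : ‖b‖ < 1) :
    ‖a + b - conj (a + b) * (a * b)‖ < 1 - ‖a * b‖ ^ 2 := by
  have ha' : 0 < 1 - ‖a‖ ^ 2 := sub_pos.2 (pow_lt_one₀ (norm_nonneg a) ha two_ne_zero)
  have hb' : 0 < 1 - ‖b‖ ^ 2 := sub_pos.2 (pow_lt_one₀ (norm_nonneg b) hb two_ne_zero)
  calc ‖a + b - conj (a + b) * (a * b)‖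
      = ‖a * ((1 - ‖b‖ ^ 2 : ℝ) : ℂ) + b * ((1 - ‖a‖ ^ 2 : ℝ) : ℂ)‖ := by
        congr 1
        push_cast
        rw [map_add]
        linear_combination -b * Complex.conj_mul' a - a * Complex.conj_mul' b
    _ ≤ ‖a‖ * (1 - ‖b‖ ^ 2) + ‖b‖ * (1 - ‖a‖ ^ 2) := by
        refine (norm_add_le _ _).trans_eq ?_
        rw [norm_mul, norm_mul, Complex.norm_of_nonneg ha'.le, Complex.norm_of_nonneg hb'.le]
    _ < 1 - ‖a * b‖ ^ 2 := by
        rw [norm_mul]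
        have hab : ‖a‖ * ‖b‖ < 1 := mul_lt_one_of_nonneg_of_lt_one_left (norm_nonneg a) ha hb.le
        linarith [mul_pos (mul_pos (sub_pos.2 ha) (sub_pos.2 hb)) (sub_pos.2 hab)]

theorem exists_norm_lt_one_add_conj_mul_eq {s p : ℂ} (h : ‖s - conj s * p‖ < 1 - ‖p‖ ^ 2) :
    ∃ b : ℂ, ‖b‖ < 1 ∧ s = b + conj b * p := by
  have hp : 0 < 1 - ‖p‖ ^ 2 := (norm_nonneg _).trans_lt h
  have hp' : ((1 - ‖p‖ ^ 2 : ℝ) : ℂ) ≠ 0 := Complex.ofReal_ne_zero.2 hp.ne'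
  refine ⟨(s - conj s * p) / ((1 - ‖p‖ ^ 2 : ℝ) : ℂ), ?_, ?_⟩
  · rwa [norm_div, Complex.norm_of_nonneg hp.le, div_lt_one hp]
  · rw [map_div₀, Complex.conj_ofReal, div_mul_eq_mul_div, ← add_div, eq_div_iff hp']
    simp only [map_sub, map_mul, Complex.conj_conj]
    push_cast
    linear_combination s * Complex.mul_conj' p

/-- The equation says that `z ↦ (w - z) / (1 - conj w * z)` maps `a` and `b` to opposite points. -/
theorem exists_hyperbolic_midpoint {a b : ℂ} (ha : ‖a‖ < 1) (hb : ‖b‖ < 1) :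
    ∃ w : ℂ, ‖w‖ < 1 ∧ (1 + ‖w‖ ^ 2) * (a + b) = 2 * (w + conj w * (a * b)) := by
  obtain ⟨c, hc, hsum⟩ := exists_norm_lt_one_add_conj_mul_eq (norm_add_sub_conj_mul_lt ha hb)
  obtain ⟨w, hw, hcw⟩ := exists_one_add_norm_sq_smul_eq_two_smul hc
  simp only [Complex.real_smul, Complex.ofReal_add, Complex.ofReal_one, Complex.ofReal_pow,
    Complex.ofReal_ofNat] at hcw
  have hcw' := congrArg conj hcw
  simp only [map_mul, map_add, map_one, map_pow, Complex.conj_ofReal, map_ofNat] at hcw'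
  exact ⟨w, hw, by linear_combination (1 + (‖w‖ : ℂ) ^ 2) * hsum + hcw + a * b * hcw'⟩

end Mobius

section Roots

open Polynomial

theorem exists_add_eq_mul_eq {k : Type*} [Field k] [IsAlgClosed k] (s p : k) :
    ∃ a b : k, a + b = s ∧ a * b = p := by
  have hdeg : (X ^ 2 - C s * X + C p).degree = 2 := by compute_degree!
  obtain ⟨a, ha⟩ := IsAlgClosed.exists_root _ (hdeg ▸ two_ne_zero)
  refine ⟨a, s - a, by ring, ?_⟩
  simp only [IsRoot.def, eval_add, eval_sub, eval_mul, eval_pow, eval_X, eval_C] at ha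
  linear_combination -ha

theorem eval_dickson_two_add_two {R : Type*} [CommRing R] (s p : R) (n : ℕ) :
    (dickson 2 p (n + 2)).eval s =
      s * (dickson 2 p (n + 1)).eval s - p * (dickson 2 p n).eval s := by
  simp

theorem eval_dickson_two_succ {R : Type*} [CommRing R] (a b : R) (n : ℕ) :
    (dickson 2 (a * b) (n + 1)).eval (a + b) =
      a * (dickson 2 (a * b) n).eval (a + b) + b ^ (n + 1) := by
  induction n with
  | zero => norm_num
  | succ n ih =>
    rw [eval_dickson_two_add_two, ih]
    ring

theorem norm_eval_dickson_two_le {R : Type*} [NormedCommRing R] [NormOneClass R] {a b : R}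
    (ha : ‖a‖ ≤ 1) (hb : ‖b‖ ≤ 1) (n : ℕ) :
    ‖(dickson 2 (a * b) n).eval (a + b)‖ ≤ n + 1 := by
  induction n with
  | zero => norm_num
  | succ n ih =>
    rw [eval_dickson_two_succ, Nat.cast_succ]
    have hpow : ‖b ^ (n + 1)‖ ≤ 1 := (norm_pow_le b _).trans (pow_le_one₀ (norm_nonneg b) hb)
    have hmul : ‖a * (dickson 2 (a * b) n).eval (a + b)‖ ≤ n + 1 :=
      (norm_mul_le _ _).trans ((mul_le_of_le_one_left (norm_nonneg _) ha).trans ih)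
    exact (norm_add_le _ _).trans (add_le_add hmul hpow)

theorem mul_tsum_eval_dickson_two {R : Type*} [CommRing R] [TopologicalSpace R]
    [IsTopologicalRing R] [T2Space R] {s p z : R}
    (h : Summable fun n => (dickson 2 p n).eval s * z ^ n) :
    (1 - s * z + p * z ^ 2) * ∑' n, (dickson 2 p n).eval s * z ^ n = 1 := by
  have h₁ := (summable_nat_add_iff 1).2 h
  have tail₁ := h.tsum_eq_zero_add
  have tail₂ := h₁.tsum_eq_zero_add
  simp only [eval_dickson_two_add_two] at tail₁ tail₂
  have recurrence : ∑' n, (s * (dickson 2 p (n + 1)).eval s - p * (dickson 2 p n).eval s) *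
      z ^ (n + 1 + 1) = s * z * ∑' n, (dickson 2 p (n + 1)).eval s * z ^ (n + 1) -
        p * z ^ 2 * ∑' n, (dickson 2 p n).eval s * z ^ n := by
    rw [← h₁.tsum_mul_left, ← h.tsum_mul_left, ← (h₁.mul_left _).tsum_sub (h.mul_left _)]
    exact tsum_congr fun n => by ring
  rw [recurrence] at tail₂
  simp only [dickson_zero, dickson_one, Nat.cast_ofNat, eval_sub, eval_ofNat, eval_X, zero_add,
    pow_zero, pow_one, mul_one] at tail₁ tail₂
  linear_combination (1 - s * z) * tail₁ + tail₂

theorem eval_eval_dickson_two_X {σ R : Type*} [CommRing R] (y : σ → R) (i j : σ) (n : ℕ) :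
    MvPolynomial.eval y ((dickson 2 (MvPolynomial.X j) n).eval (MvPolynomial.X i)) =
      (dickson 2 (y j) n).eval (y i) := by
  rw [← eval_map_apply, map_dickson, MvPolynomial.eval_X, MvPolynomial.eval_X]

end Roots

section MatrixNorm

open Matrix
open scoped Matrix.Norms.L2Operator MatrixOrder ComplexOrder

variable {A : Matrix (Fin 2) (Fin 2) ℂ}

theorem matrixUnitBall_eq_ball : matrixUnitBall = Metric.ball 0 1 := by
  ext A
  simp only [matrixUnitBall, Set.mem_ofPred_eq, mem_ball_zero_iff, cstar_norm_def]

theorem norm_pow_four_sub_sum_mul_norm_sq_add (A : Matrix (Fin 2) (Fin 2) ℂ) :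
    ‖A‖ ^ 4 - (∑ i, ∑ j, ‖A i j‖ ^ 2) * ‖A‖ ^ 2 + ‖A.det‖ ^ 2 = 0 := by
  have spec : ‖Aᴴ * A‖ ∈ spectrum ℝ (Aᴴ * A) :=
    CStarAlgebra.norm_mem_spectrum_of_nonneg (star_mul_self_nonneg A)
  have root := (mem_spectrum_iff_isRoot_charpoly).1 (spectrum.algebraMap_mem ℂ spec)
  have conj_entry (a : ℂ) : star a * a = ((‖a‖ ^ 2 : ℝ) : ℂ) := by
    rw [Complex.ofReal_pow]
    exact Complex.conj_mul' a
  have trace_eq : (Aᴴ * A).trace = ((∑ i, ∑ j, ‖A i j‖ ^ 2 : ℝ) : ℂ) := by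
    rw [Finset.sum_comm]
    simp only [trace, diag_apply, mul_apply, conjTranspose_apply, conj_entry, Complex.ofReal_sum]
  have det_eq : (Aᴴ * A).det = ((‖A.det‖ ^ 2 : ℝ) : ℂ) := by
    rw [det_mul, det_conjTranspose, conj_entry]
  rw [Polynomial.IsRoot.def, charpoly_fin_two, trace_eq, det_eq, l2_opNorm_conjTranspose_mul_self]
    at root
  simp only [Polynomial.eval_add, Polynomial.eval_sub, Polynomial.eval_mul, Polynomial.eval_pow,
    Polynomial.eval_X, Polynomial.eval_C, Complex.coe_algebraMap] at root
  norm_cast at root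
  linear_combination root

theorem norm_lt_one_of_sum_norm_sq_lt (hdet : ‖A.det‖ < 1)
    (hsum : ∑ i, ∑ j, ‖A i j‖ ^ 2 < 1 + ‖A.det‖ ^ 2) : ‖A‖ < 1 := by
  by_contra! hA
  have hdet' : ‖A.det‖ ^ 2 < 1 := pow_lt_one₀ (norm_nonneg _) hdet two_ne_zero
  have hA' : 1 ≤ ‖A‖ ^ 2 := one_le_pow₀ hA
  have := mul_pos (one_pos.trans_le hA') (sub_pos.2 hsum)
  have := mul_nonneg (sub_nonneg.2 hA') (sub_nonneg.2 (hdet'.le.trans hA'))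
  linarith [norm_pow_four_sub_sum_mul_norm_sq_add A]

theorem norm_le_norm_of_sq_sub_trace_mul_add_det_eq_zero {l : ℂ}
    (hl : l ^ 2 - A.trace * l + A.det = 0) : ‖l‖ ≤ ‖A‖ := by
  refine spectrum.norm_le_norm_of_mem (mem_spectrum_of_isRoot_charpoly (B := A) (r := l) ?_)
  simpa [charpoly_fin_two] using hl

theorem norm_apply_one_zero_mul_le (hA : ‖A‖ ≤ 1) {z : ℂ} (hz : ‖z‖ ≤ 1) :
    ‖A 1 0‖ * (1 - ‖z‖ ^ 2) ≤ ‖1 - A.trace * z + A.det * z ^ 2‖ := by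
  -- `v` is the first column of the adjugate of `1 - z • A`.
  set v : EuclideanSpace ℂ (Fin 2) := !₂[1 - z * A 1 1, z * A 1 0]
  set u : EuclideanSpace ℂ (Fin 2) := WithLp.toLp 2 (A *ᵥ v)
  have huv : ‖u‖ ≤ ‖v‖ :=
    (l2_opNorm_mulVec A v).trans (mul_le_of_le_one_left (norm_nonneg v) hA)
  have resolvent : v - z • u = PiLp.single 2 0 (1 - A.trace * z + A.det * z ^ 2) := by
    ext i
    fin_cases i
    · simp only [u, v, mulVec_fin_two, trace_fin_two, det_fin_two, cons_val, Fin.zero_eta,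
        PiLp.sub_apply, PiLp.smul_apply, PiLp.single_eq_same, smul_eq_mul]
      ring
    · simp only [u, v, mulVec_fin_two, cons_val, Fin.mk_one, PiLp.sub_apply, PiLp.smul_apply,
        ne_eq, one_ne_zero, not_false_eq_true, PiLp.single_eq_of_ne, smul_eq_mul]
      ring
  have entry : (u - conj z • v) 1 = A 1 0 * ((1 - ‖z‖ ^ 2 : ℝ) : ℂ) := by
    simp only [u, v, mulVec_fin_two, cons_val, PiLp.sub_apply, PiLp.smul_apply, smul_eq_mul,
      Complex.ofReal_sub, Complex.ofReal_one, Complex.ofReal_pow, ← Complex.conj_mul']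
    ring
  have hz' : 0 ≤ 1 - ‖z‖ ^ 2 := sub_nonneg.2 (pow_le_one₀ (norm_nonneg z) hz)
  calc ‖A 1 0‖ * (1 - ‖z‖ ^ 2) = ‖(u - conj z • v) 1‖ := by
        rw [entry, norm_mul, Complex.norm_of_nonneg hz']
    _ ≤ ‖u - conj z • v‖ := PiLp.norm_apply_le _ _
    _ ≤ ‖v - z • u‖ := norm_sub_conj_smul_le hz huv
    _ = ‖1 - A.trace * z + A.det * z ^ 2‖ := by rw [resolvent, PiLp.norm_single]

theorem continuous_pentablockMap : Continuous pentablockMap := by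
  unfold pentablockMap
  fun_prop

theorem pentablockMap_eq_of_sq_add_mul_eq {x : Fin 3 → ℂ} {y c : ℂ}
    (h : y ^ 2 + c * x 0 = x 1 ^ 2 / 4 - x 2) :
    pentablockMap !![x 1 / 2 + y, c; x 0, x 1 / 2 - y] = x := by
  have htrace : x 1 / 2 + y + (x 1 / 2 - y) = x 1 := by ring
  have hdet : (x 1 / 2 + y) * (x 1 / 2 - y) - c * x 0 = x 2 := by linear_combination -h
  rw [pentablockMap, trace_fin_two_of, det_fin_two_of, htrace, hdet]
  funext i
  fin_cases i <;> rfl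

theorem isOpenMap_pentablockMap : IsOpenMap pentablockMap := by
  refine isOpenMap_iff_nhds_le.2 fun A U hU => ?_
  let lift (q : (Fin 3 → ℂ) × ℂ) : Matrix (Fin 2) (Fin 2) ℂ :=
    !![q.1 1 / 2 + q.2, A 0 1; q.1 0, q.1 1 / 2 - q.2]
  let square (x : Fin 3 → ℂ) : ℂ := x 1 ^ 2 / 4 - x 2 - A 0 1 * x 0
  let y₀ : ℂ := (A 0 0 - A 1 1) / 2
  have lift_eq : lift (pentablockMap A, y₀) = A := by
    have h₀₀ : A.trace / 2 + y₀ = A 0 0 := by rw [trace_fin_two]; ring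
    have h₁₁ : A.trace / 2 - y₀ = A 1 1 := by rw [trace_fin_two]; ring
    exact (congrArg₂ (fun a d => !![a, A 0 1; A 1 0, d]) h₀₀ h₁₁).trans (eta_fin_two A).symm
  have square_eq : square (pentablockMap A) = y₀ ^ 2 := by
    simp only [square, y₀, pentablockMap, trace_fin_two, det_fin_two, cons_val]
    ring
  have lift_tendsto : Tendsto lift (𝓝 (pentablockMap A) ×ˢ 𝓝 y₀) (𝓝 A) := by
    have lift_continuous : Continuous lift := by fun_prop
    simpa only [lift_eq, nhds_prod_eq] using lift_continuous.tendsto (pentablockMap A, y₀)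
  obtain ⟨P, hP, Q, hQ, hPQ⟩ := eventually_prod_iff.1 (lift_tendsto.eventually hU)
  have sq_image : (· ^ 2) '' {y | Q y} ∈ 𝓝 (square (pentablockMap A)) :=
    square_eq ▸ (Complex.isOpenQuotientMap_pow 2).isOpenMap.image_mem_nhds hQ
  have square_continuous : Continuous square := by fun_prop
  filter_upwards [hP, square_continuous.continuousAt.eventually_mem sq_image]
    with x hx ⟨y, hy, hyx⟩
  exact pentablockMap_eq_of_sq_add_mul_eq (eq_sub_iff_add_eq.1 hyx) ▸ hPQ hx hy

theorem isOpen_pentablock : IsOpen pentablock := by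
  rw [pentablock, matrixUnitBall_eq_ball]
  exact isOpenMap_pentablockMap _ Metric.isOpen_ball

theorem isConnected_pentablock : IsConnected pentablock := by
  rw [pentablock, matrixUnitBall_eq_ball]
  exact ((convex_ball _ _).isConnected (Metric.nonempty_ball.2 one_pos)).image _
    continuous_pentablockMap.continuousOn

theorem isCompact_closure_pentablock : IsCompact (closure pentablock) := by
  have : ProperSpace (Matrix (Fin 2) (Fin 2) ℂ) := FiniteDimensional.proper ℂ _
  rw [pentablock, matrixUnitBall_eq_ball]
  exact ((isCompact_closedBall 0 1).image continuous_pentablockMap).closure_of_subset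
    (Set.image_mono Metric.ball_subset_closedBall)

end MatrixNorm

section Sufficiency

variable {x : Fin 3 → ℂ}

theorem exists_sq_add_mul_eq_norm_sq_lt {a m : ℂ} {α β : ℝ} (hβ : 0 ≤ β) (hβα : β < α)
    (hm : ‖m‖ = α * β) (ha : ‖a‖ < α) :
    ∃ y c : ℂ, y ^ 2 + c * a = m ∧ 2 * ‖y‖ ^ 2 + ‖c‖ ^ 2 + ‖a‖ ^ 2 < α ^ 2 + β ^ 2 := by
  rcases le_or_gt (‖a‖ ^ 2) ‖m‖ with ham | ham
  · -- With `c * a` a nonnegative multiple of `m` and `‖c‖ = ‖a‖`, the sum is `2 * ‖m‖`.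
    obtain ⟨u, hu, hmu⟩ : ∃ u : ℂ, ‖u‖ = 1 ∧ ‖m‖ * u = m :=
      ⟨_, Complex.norm_exp_ofReal_mul_I m.arg, Complex.norm_mul_exp_arg_mul_I m⟩
    obtain ⟨y, hy⟩ := IsAlgClosed.exists_pow_nat_eq (((‖m‖ - ‖a‖ ^ 2 : ℝ) : ℂ) * u) two_pos
    have hynorm : ‖y‖ ^ 2 = ‖m‖ - ‖a‖ ^ 2 := by
      rw [← norm_pow, hy, norm_mul, hu, mul_one, Complex.norm_of_nonneg (sub_nonneg.2 ham)]
    refine ⟨y, u * conj a, ?_, ?_⟩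
    · rw [hy]
      push_cast
      linear_combination hmu + u * Complex.conj_mul' a
    · rw [norm_mul, hu, one_mul, RCLike.norm_conj, hynorm, hm]
      linarith [sq_pos_of_pos (sub_pos.2 hβα)]
  · have ha₀ : 0 < ‖a‖ ^ 2 := (norm_nonneg m).trans_lt ham
    have ha₀' : a ≠ 0 := norm_ne_zero_iff.1 (pow_ne_zero_iff two_ne_zero |>.1 ha₀.ne')
    refine ⟨0, m / a, by simp [ha₀'], ?_⟩
    have hca : ‖m / a‖ ^ 2 * ‖a‖ ^ 2 = α ^ 2 * β ^ 2 := by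
      rw [← mul_pow, ← norm_mul, div_mul_cancel₀ _ ha₀', hm, mul_pow]
    have h₁ : 0 < α ^ 2 - ‖a‖ ^ 2 := sub_pos.2 (pow_lt_pow_left₀ ha (norm_nonneg a) two_ne_zero)
    have h₂ : 0 < ‖a‖ ^ 2 - β ^ 2 := by
      rw [hm] at ham
      nlinarith
    have := mul_pos h₁ h₂
    rw [norm_zero]
    refine lt_of_mul_lt_mul_right ?_ ha₀.le
    linarith

theorem mem_pentablock_of_sq_add_mul_eq {y c : ℂ} (hp : ‖x 2‖ < 1)
    (h : y ^ 2 + c * x 0 = x 1 ^ 2 / 4 - x 2)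
    (hsum : 2 * ‖y‖ ^ 2 + ‖c‖ ^ 2 + ‖x 0‖ ^ 2 + ‖x 1‖ ^ 2 / 2 < 1 + ‖x 2‖ ^ 2) :
    x ∈ pentablock := by
  set A := !![x 1 / 2 + y, c; x 0, x 1 / 2 - y] with hA
  have hAx : pentablockMap A = x := pentablockMap_eq_of_sq_add_mul_eq h
  have hdet : A.det = x 2 := congrFun hAx 2
  have hhalf : ‖x 1 / 2‖ = ‖x 1‖ / 2 := by rw [norm_div, RCLike.norm_ofNat]
  have hentries : ∑ i, ∑ j, ‖A i j‖ ^ 2 =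
      2 * ‖y‖ ^ 2 + ‖c‖ ^ 2 + ‖x 0‖ ^ 2 + ‖x 1‖ ^ 2 / 2 := by
    have := parallelogram_law_with_norm ℂ (x 1 / 2) y
    rw [hhalf] at this
    simp only [hA, Fin.sum_univ_two, Matrix.of_apply, Matrix.cons_val]
    linarith
  refine ⟨A, norm_lt_one_of_sum_norm_sq_lt (hdet ▸ hp) ?_, hAx⟩
  rwa [hdet, hentries]

theorem norm_one_sub_conj_sq_mul_sq_add (w p : ℂ) :
    ‖1 - conj w ^ 2 * p‖ ^ 2 + ‖w ^ 2 - p‖ ^ 2 + 2 * ‖w + conj w * p‖ ^ 2 =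
      (1 + ‖p‖ ^ 2) * (1 + ‖w‖ ^ 2) ^ 2 := by
  simp only [← Complex.normSq_eq_norm_sq, Complex.normSq_apply]
  simp only [pow_two, Complex.sub_re, Complex.sub_im, Complex.add_re, Complex.add_im,
    Complex.mul_re, Complex.mul_im, Complex.conj_re, Complex.conj_im, Complex.one_re,
    Complex.one_im]
  ring

theorem mem_pentablock_of_midpoint {w : ℂ} (hw : ‖w‖ < 1) (hp : ‖x 2‖ < 1)
    (hs : (1 + ‖w‖ ^ 2) * x 1 = 2 * (w + conj w * x 2))
    (ha : ‖x 0‖ * (1 + ‖w‖ ^ 2) < ‖1 - conj w ^ 2 * x 2‖) : x ∈ pentablock := by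
  have ht : 0 < 1 + ‖w‖ ^ 2 := by positivity
  have ht' : (1 + ‖w‖ ^ 2 : ℂ) ≠ 0 := mod_cast ht.ne'
  have hnorm_t : ‖(1 + ‖w‖ ^ 2 : ℂ)‖ = 1 + ‖w‖ ^ 2 := mod_cast Complex.norm_of_nonneg ht.le
  have hdisc : x 1 ^ 2 / 4 - x 2 =
      (1 - conj w ^ 2 * x 2) / (1 + ‖w‖ ^ 2) * ((w ^ 2 - x 2) / (1 + ‖w‖ ^ 2)) := by
    rw [eq_div_of_mul_eq ht' ((mul_comm _ _).trans hs)]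
    field_simp
    rw [← Complex.mul_conj']
    ring
  have hs_norm : ‖x 1‖ = 2 * ‖w + conj w * x 2‖ / (1 + ‖w‖ ^ 2) := by
    rw [eq_div_of_mul_eq ht' ((mul_comm _ _).trans hs), norm_div, norm_mul, hnorm_t,
      RCLike.norm_ofNat]
  have hlt : ‖w ^ 2 - x 2‖ < ‖1 - conj w ^ 2 * x 2‖ := by
    have := norm_sub_conj_smul_lt (z := conj w ^ 2) (u := x 2) (v := (1 : ℂ))
      (by simpa using pow_lt_one₀ (norm_nonneg w) hw two_ne_zero) (by simpa using hp)
    simpa [norm_sub_rev] using this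
  obtain ⟨y, c, hyc, hsum⟩ := exists_sq_add_mul_eq_norm_sq_lt (a := x 0) (m := x 1 ^ 2 / 4 - x 2)
    (α := ‖1 - conj w ^ 2 * x 2‖ / (1 + ‖w‖ ^ 2)) (β := ‖w ^ 2 - x 2‖ / (1 + ‖w‖ ^ 2))
    (by positivity) (by gcongr) (by rw [hdisc, norm_mul, norm_div, norm_div, hnorm_t])
    ((lt_div_iff₀ ht).2 ha)
  refine mem_pentablock_of_sq_add_mul_eq hp hyc ?_
  calc 2 * ‖y‖ ^ 2 + ‖c‖ ^ 2 + ‖x 0‖ ^ 2 + ‖x 1‖ ^ 2 / 2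
      < (‖1 - conj w ^ 2 * x 2‖ / (1 + ‖w‖ ^ 2)) ^ 2 + (‖w ^ 2 - x 2‖ / (1 + ‖w‖ ^ 2)) ^ 2 +
          ‖x 1‖ ^ 2 / 2 := by linarith
    _ = (‖1 - conj w ^ 2 * x 2‖ ^ 2 + ‖w ^ 2 - x 2‖ ^ 2 + 2 * ‖w + conj w * x 2‖ ^ 2) /
          (1 + ‖w‖ ^ 2) ^ 2 := by
        rw [hs_norm]
        field_simp
    _ = 1 + ‖x 2‖ ^ 2 := by
        rw [norm_one_sub_conj_sq_mul_sq_add, mul_div_cancel_right₀ _ (by positivity)]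

theorem mem_pentablock_of_norm_apply_zero_mul_lt {a b : ℂ} (ha : ‖a‖ < 1) (hb : ‖b‖ < 1)
    (hs : a + b = x 1) (hp : a * b = x 2)
    (h : ∀ z : ℂ, ‖z‖ < 1 → ‖x 0‖ * (1 - ‖z‖ ^ 2) < ‖1 - x 1 * z + x 2 * z ^ 2‖) :
    x ∈ pentablock := by
  obtain ⟨w, hw, hmid⟩ := exists_hyperbolic_midpoint ha hb
  rw [hs, hp] at hmid
  have hp' : ‖x 2‖ < 1 := by
    rw [← hp, norm_mul]
    exact mul_lt_one_of_nonneg_of_lt_one_left (norm_nonneg a) ha hb.le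
  have ht : 0 < 1 + ‖w‖ ^ 2 := by positivity
  have hd : 0 < 1 - ‖w‖ ^ 2 := sub_pos.2 (pow_lt_one₀ (norm_nonneg w) hw two_ne_zero)
  have hq : (1 + ‖w‖ ^ 2) * ‖1 - x 1 * conj w + x 2 * conj w ^ 2‖ =
      (1 - ‖w‖ ^ 2) * ‖1 - conj w ^ 2 * x 2‖ := by
    have key : ((1 + ‖w‖ ^ 2 : ℝ) : ℂ) * (1 - x 1 * conj w + x 2 * conj w ^ 2) =
        ((1 - ‖w‖ ^ 2 : ℝ) : ℂ) * (1 - conj w ^ 2 * x 2) := by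
      push_cast
      linear_combination -conj w * hmid - 2 * Complex.mul_conj' w
    simpa only [norm_mul, Complex.norm_of_nonneg ht.le, Complex.norm_of_nonneg hd.le]
      using congrArg norm key
  refine mem_pentablock_of_midpoint hw hp' hmid (lt_of_mul_lt_mul_left ?_ hd.le)
  calc (1 - ‖w‖ ^ 2) * (‖x 0‖ * (1 + ‖w‖ ^ 2))
      = (1 + ‖w‖ ^ 2) * (‖x 0‖ * (1 - ‖conj w‖ ^ 2)) := by
        rw [RCLike.norm_conj]
        ring
    _ < (1 + ‖w‖ ^ 2) * ‖1 - x 1 * conj w + x 2 * conj w ^ 2‖ := by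
        gcongr
        exact h _ (by rwa [RCLike.norm_conj])
    _ = (1 - ‖w‖ ^ 2) * ‖1 - conj w ^ 2 * x 2‖ := hq

end Sufficiency

section Hull

open Polynomial
open scoped Matrix.Norms.L2Operator

variable {x : Fin 3 → ℂ} {z : ℂ}

theorem norm_apply_zero_mul_le_of_mem_pentablock (hx : x ∈ pentablock) (hz : ‖z‖ ≤ 1) :
    ‖x 0‖ * (1 - ‖z‖ ^ 2) ≤ ‖1 - x 1 * z + x 2 * z ^ 2‖ := by
  obtain ⟨A, hA, rfl⟩ := hx
  rw [matrixUnitBall_eq_ball, mem_ball_zero_iff] at hA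
  exact norm_apply_one_zero_mul_le hA.le hz

theorem norm_eval_dickson_two_le_of_mem_pentablock (hx : x ∈ pentablock) (n : ℕ) :
    ‖(dickson 2 (x 2) n).eval (x 1)‖ ≤ n + 1 := by
  obtain ⟨A, hA, rfl⟩ := hx
  rw [matrixUnitBall_eq_ball, mem_ball_zero_iff] at hA
  change ‖(dickson 2 A.det n).eval A.trace‖ ≤ n + 1
  obtain ⟨a, b, hsum, hprod⟩ := exists_add_eq_mul_eq A.trace A.det
  have ha : ‖a‖ ≤ ‖A‖ := norm_le_norm_of_sq_sub_trace_mul_add_det_eq_zero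
    (by linear_combination a * hsum - hprod)
  have hb : ‖b‖ ≤ ‖A‖ := norm_le_norm_of_sq_sub_trace_mul_add_det_eq_zero
    (by linear_combination b * hsum - hprod)
  rw [← hsum, ← hprod]
  exact norm_eval_dickson_two_le (ha.trans hA.le) (hb.trans hA.le) n

theorem norm_apply_zero_le_one_of_mem_polynomialHull (hx : x ∈ polynomialHull pentablock) :
    ‖x 0‖ ≤ 1 := by
  simpa using hx (MvPolynomial.X 0) 1 fun y hy => by
    simpa using norm_apply_zero_mul_le_of_mem_pentablock hy (z := 0) (by simp)

theorem norm_eval_dickson_two_le_of_mem_polynomialHull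
    (hx : x ∈ polynomialHull pentablock) (n : ℕ) :
    ‖(dickson 2 (x 2) n).eval (x 1)‖ ≤ n + 1 := by
  rw [← eval_eval_dickson_two_X x 1 2]
  refine hx _ _ fun y hy => ?_
  rw [eval_eval_dickson_two_X]
  exact norm_eval_dickson_two_le_of_mem_pentablock hy n

theorem summable_add_one_mul_pow {R : Type*} [NormedRing R] [CompleteSpace R] {r : R}
    (hr : ‖r‖ < 1) : Summable fun n : ℕ => ((n : R) + 1) * r ^ n := by
  simpa [add_mul] using
    (summable_pow_mul_geometric_of_norm_lt_one 1 hr).add (summable_geometric_of_norm_lt_one hr)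

theorem norm_eval_dickson_two_mul_pow_le (hx : x ∈ polynomialHull pentablock) (z : ℂ) (n : ℕ) :
    ‖(dickson 2 (x 2) n).eval (x 1) * z ^ n‖ ≤ (n + 1) * ‖z‖ ^ n := by
  rw [norm_mul, norm_pow]
  gcongr
  exact norm_eval_dickson_two_le_of_mem_polynomialHull hx n

theorem mul_tsum_eval_dickson_two_of_mem_polynomialHull (hx : x ∈ polynomialHull pentablock)
    (hz : ‖z‖ < 1) :
    (1 - x 1 * z + x 2 * z ^ 2) * ∑' n, (dickson 2 (x 2) n).eval (x 1) * z ^ n = 1 :=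
  have hz' : ‖‖z‖‖ < 1 := (norm_norm z).trans_lt hz
  mul_tsum_eval_dickson_two <|
    (summable_add_one_mul_pow hz').of_norm_bounded (norm_eval_dickson_two_mul_pow_le hx z)

theorem one_sub_mul_add_mul_sq_ne_zero_of_mem_polynomialHull
    (hx : x ∈ polynomialHull pentablock) (hz : ‖z‖ < 1) : 1 - x 1 * z + x 2 * z ^ 2 ≠ 0 :=
  left_ne_zero_of_mul_eq_one (mul_tsum_eval_dickson_two_of_mem_polynomialHull hx hz)

theorem tendstoUniformlyOn_polynomialHull_pentablock (hz : ‖z‖ < 1) :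
    TendstoUniformlyOn
      (fun N y => MvPolynomial.eval y (∑ n ∈ Finset.range N, MvPolynomial.X 0 *
        ((dickson 2 (MvPolynomial.X 2) n).eval (MvPolynomial.X 1) * MvPolynomial.C (z ^ n))))
      (fun y => y 0 / (1 - y 1 * z + y 2 * z ^ 2)) atTop (polynomialHull pentablock) := by
  simp only [map_sum, map_mul, MvPolynomial.eval_X, MvPolynomial.eval_C, eval_eval_dickson_two_X]
  refine (tendstoUniformlyOn_tsum_nat (summable_add_one_mul_pow ((norm_norm z).trans_lt hz))
    fun n y hy => ?_).congr_right fun y hy => ?_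
  · rw [norm_mul]
    exact (mul_le_of_le_one_left (norm_nonneg _)
      (norm_apply_zero_le_one_of_mem_polynomialHull hy)).trans
        (norm_eval_dickson_two_mul_pow_le hy z n)
  · simp only [tsum_mul_left]
    rw [div_eq_mul_inv, eq_inv_of_mul_eq_one_right
      (mul_tsum_eval_dickson_two_of_mem_polynomialHull hy hz)]

theorem norm_apply_zero_mul_le_of_mem_polynomialHull (hx : x ∈ polynomialHull pentablock)
    (hz : ‖z‖ < 1) : ‖x 0‖ * (1 - ‖z‖ ^ 2) ≤ ‖1 - x 1 * z + x 2 * z ^ 2‖ := by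
  have hz' : 0 < 1 - ‖z‖ ^ 2 := sub_pos.2 (pow_lt_one₀ (norm_nonneg z) hz two_ne_zero)
  have quotient_le_iff {y : Fin 3 → ℂ} (hy : y ∈ polynomialHull pentablock) :
      ‖y 0 / (1 - y 1 * z + y 2 * z ^ 2)‖ ≤ (1 - ‖z‖ ^ 2)⁻¹ ↔
        ‖y 0‖ * (1 - ‖z‖ ^ 2) ≤ ‖1 - y 1 * z + y 2 * z ^ 2‖ := by
    have hq := norm_pos_iff.2 (one_sub_mul_add_mul_sq_ne_zero_of_mem_polynomialHull hy hz)
    rw [norm_div, div_le_iff₀ hq, ← div_eq_inv_mul, le_div_iff₀ hz']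
  exact (quotient_le_iff hx).1 <| norm_le_of_tendstoUniformlyOn_polynomialHull
    (tendstoUniformlyOn_polynomialHull_pentablock hz)
    (fun y hy => (quotient_le_iff (subset_polynomialHull _ hy)).2
      (norm_apply_zero_mul_le_of_mem_pentablock hy hz.le)) hx

theorem norm_le_one_of_mem_polynomialHull (hx : x ∈ polynomialHull pentablock) {a b : ℂ}
    (hs : a + b = x 1) (hp : a * b = x 2) : ‖a‖ ≤ 1 := by
  by_contra! ha
  have ha₀ : a ≠ 0 := norm_pos_iff.1 (one_pos.trans ha)
  refine one_sub_mul_add_mul_sq_ne_zero_of_mem_polynomialHull hx (z := a⁻¹)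
    (by rw [norm_inv]; exact inv_lt_one_of_one_lt₀ ha) ?_
  rw [← hs, ← hp]
  field_simp
  ring

theorem mapsTo_weightedDilation_polynomialHull_pentablock {r : ℝ} (hr : r ∈ Set.Ioo 0 1) :
    Set.MapsTo (weightedDilation ![1, 1, 2] r) (polynomialHull pentablock) pentablock := by
  intro x hx
  obtain ⟨a, b, hs, hp⟩ := exists_add_eq_mul_eq (x 1) (x 2)
  have ha := norm_le_one_of_mem_polynomialHull hx hs hp
  have hb := norm_le_one_of_mem_polynomialHull hx
    ((add_comm b a).trans hs) ((mul_comm b a).trans hp)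
  have hnorm_r : ‖(r : ℂ)‖ = r := Complex.norm_of_nonneg hr.1.le
  have norm_mul_lt {c : ℂ} (hc : ‖c‖ ≤ 1) : ‖r * c‖ < 1 := by
    rw [norm_mul, hnorm_r]
    exact (mul_le_of_le_one_right hr.1.le hc).trans_lt hr.2
  refine mem_pentablock_of_norm_apply_zero_mul_lt (norm_mul_lt ha) (norm_mul_lt hb)
    (by simp [weightedDilation, ← hs, mul_add])
    (by simp [weightedDilation, ← hp, sq, mul_mul_mul_comm]) fun z hz => ?_
  have hrz : ‖r * z‖ < 1 := norm_mul_lt hz.le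
  have hx0 : ‖weightedDilation ![1, 1, 2] r x 0‖ = r * ‖x 0‖ := by
    simp [weightedDilation, hr.1.le]
  have hq : 1 - weightedDilation ![1, 1, 2] r x 1 * z + weightedDilation ![1, 1, 2] r x 2 * z ^ 2 =
      1 - x 1 * (r * z) + x 2 * (r * z) ^ 2 := by
    simp only [weightedDilation, Matrix.cons_val, pow_one]
    ring
  rw [hx0, hq]
  rcases eq_or_ne (x 0) 0 with h₀ | h₀
  · simpa [h₀] using one_sub_mul_add_mul_sq_ne_zero_of_mem_polynomialHull hx hrz
  · refine lt_of_lt_of_le ?_ (norm_apply_zero_mul_le_of_mem_polynomialHull hx hrz)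
    have : r * (1 - ‖z‖ ^ 2) < 1 - ‖r * z‖ ^ 2 := by
      rw [norm_mul, hnorm_r]
      nlinarith [mul_pos (sub_pos.2 hr.2) (add_pos_of_pos_of_nonneg one_pos
        (mul_nonneg hr.1.le (sq_nonneg ‖z‖)))]
    calc r * ‖x 0‖ * (1 - ‖z‖ ^ 2) = ‖x 0‖ * (r * (1 - ‖z‖ ^ 2)) := by ring
      _ < ‖x 0‖ * (1 - ‖r * z‖ ^ 2) := by gcongr

end Hull

theorem mainTheorem4 :
    IsPolynomiallyConvexDomain pentablock ∧
      IsPolynomiallyConvexCompact (closure pentablock) := by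
  have dilation_mem (r : ℝ) (hr : r ∈ Set.Ioo 0 1) :=
    mapsTo_weightedDilation_polynomialHull_pentablock hr
  exact ⟨⟨isOpen_pentablock, isConnected_pentablock,
      fun _ => polynomialHull_subset_of_weightedDilation isOpen_pentablock dilation_mem⟩,
    ⟨isCompact_closure_pentablock, polynomialHull_closure_eq_of_weightedDilation dilation_mem⟩⟩
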